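/- Translational invariance. Let $\Omega\subset\mathbb{R}^2$ be open (for instance a bounded domain), $T>0$, $X_0(\Omega)=L^2(\Omega)^2$, $X_1(\Omega)=H^1(\Omega)^2$, and let $D$ be a cross-diffusion operator that sends functions ${\bf u}({\bf x},t)$ with values in $\mathbb{R}^2$ to fields $D({\bf u})({\bf x},t)$ of real $2\times2$ matrices. Assume that there are $\alpha,L,M>0$ such that for all ${\bf u},{\bf v}$, all $({\bf x},t)\in\overline\Omega\times[0,T]$, all $\xi\in\mathbb{R}^2$ and $i,j=1,2$: (H1) $\xi^TD({\bf u})({\bf x},t)\xi\ge\alpha|\xi|^2$; (H2) $|D_{ij}({\bf v})({\bf x},t)-D_{ij}({\bf u})({\bf x},t)|\le L|{\bf v}({\bf x},t)-{\bf u}({\bf x},t)|$; (H3) $|D_{ij}({\bf u})({\bf x},t)|\le M$. A weak solution on $\Omega\times(0,T]$ with initial value ${\bf u}_0\in X_0(\Omega)$ is a ${\bf u}\in C([0,T];X_0(\Omega))\cap L^2(0,T;X_1(\Omega))$ with $\partial_t{\bf u}\in L^2(0,T;X_1(\Omega)')$, ${\bf u}(0)={\bf u}_0$ and, for almost every $t\in(0,T)$,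 $$\langle\partial_t{\bf u}(t),{\bf w}\rangle+\int_\Omega \mathrm{tr}\big((J{\bf w})^TD({\bf u})\,J{\bf u}\big)\,d{\bf x}=0\quad\text{for all }{\bf w}\in X_1(\Omega),$$ where the integrand is integrable and $J$ denotes the Jacobian matrix. (This is the weak form of $\partial_tu_i=\mathrm{div}(\sum_jD_{ij}({\bf u})\nabla u_j)$ with Neumann condition $\sum_jD_{ij}({\bf u})\,\partial u_j/\partial n=0$.) The scale-space operator is $T_t^{\Omega}({\bf u}_0)={\bf u}(t)$, where ${\bf u}$ is the unique weak solution with initial value ${\bf u}_0$; it is defined at those ${\bf u}_0$ that have a unique weak solution. Let ${\bf h}\in\mathbb{R}^2$, $\Omega-{\bf h}=\{{\bf x}:{\bf x}+{\bf h}\in\Omega\}$, and let $\tau_{\bf h}:X_0(\Omega)\to X_0(\Omega-{\bf h})$, $\tau_{\bf h}{\bf u}({\bf x})={\bf u}({\bf x}+{\bf h})$. Assume that $D$ is invariant under this translation, that is, $D(\tau_{\bf h}{\bf u})({\bf x},t)=D({\bf u})({\bf x}+{\bf h},t)$ for all ${\bf u}$, all ${\bf x}\in\Omega-{\bf h}$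 and all $t\in[0,T]$. (This holds in particular if $D({\bf u})({\bf x},t)=A({\bf u}({\bf x},t))$ for a matrix-valued function $A$ on $\mathbb{R}^2$.) Then, for every ${\bf u}_0\in X_0(\Omega)$, a curve ${\bf u}\in C([0,T];X_0(\Omega))$ is a weak solution on $\Omega$ with initial value ${\bf u}_0$ if and only if $\tau_{\bf h}{\bf u}$ is a weak solution on $\Omega-{\bf h}$ with initial value $\tau_{\bf h}{\bf u}_0$; and $$T_t^{\Omega-{\bf h}}(\tau_{\bf h}{\bf u}_0)=\tau_{\bf h}\big(T_t^{\Omega}({\bf u}_0)\big),\qquad 0\le t\le T,$$ where one side is defined if and only if the other is. In particular, for $\Omega=\mathbb{R}^2$, $T_t(\tau_{\bf h}{\bf u}_0)=\tau_{\bf h}(T_t({\bf u}_0))$. -/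

import Mathlib

open MeasureTheory Set
open scoped ContDiff ENNReal

noncomputable section

namespace CrossDiffusion

/-- The plane `ℝ²` with its Euclidean norm. It contains both the points `x` and the values
`(u, v)` of the unknowns. -/
abbrev Plane : Type := EuclideanSpace ℝ (Fin 2)

/-- `2 × 2` real arrays with the Frobenius norm; the entry `(i, j)` of a Jacobian is `∂ⱼ uᵢ`. -/
abbrev Jac : Type := EuclideanSpace ℝ (Fin 2 × Fin 2)

/-- The array `J`, read as a `2 × 2` matrix. -/
def Jac.toMatrix (J : Jac) : Matrix (Fin 2) (Fin 2) ℝ := Matrix.of fun i j => J (i, j)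

/-- `X₀ = L²(Ω) × L²(Ω)`, as the space of square integrable `ℝ²`-valued functions on `Ω`. -/
abbrev X0 (Ω : Set Plane) : Type := Lp Plane 2 (volume.restrict Ω)

/-- Square integrable fields of `2 × 2` arrays on `Ω`. -/
abbrev L2Jac (Ω : Set Plane) : Type := Lp Jac 2 (volume.restrict Ω)

/-- Smooth real functions on the plane with compact support contained in `Ω`. -/
structure IsTestFunction (Ω : Set Plane) (φ : Plane → ℝ) : Prop where
  smooth : ContDiff ℝ ∞ φ
  hasCompactSupport : HasCompactSupport φ
  tsupport_subset : tsupport φ ⊆ Ω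

/-- The partial derivative `∂ⱼ φ`. -/
def partialDeriv (j : Fin 2) (φ : Plane → ℝ) (x : Plane) : ℝ :=
  fderiv ℝ φ x (EuclideanSpace.single j 1)

/-- `G` is the weak Jacobian of `u` on `Ω`: `∫ uᵢ ∂ⱼφ = - ∫ Gᵢⱼ φ` for all test functions `φ`. -/
def IsWeakJacobian (Ω : Set Plane) (u : X0 Ω) (G : L2Jac Ω) : Prop :=
  ∀ φ : Plane → ℝ, IsTestFunction Ω φ → ∀ i j : Fin 2,
    ∫ x in Ω, u x i * partialDeriv j φ x = - ∫ x in Ω, G x (i, j) * φ x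

theorem integrable_coord_mul {ι : Type} [Fintype ι] {Ω : Set Plane}
    (f : Lp (EuclideanSpace ℝ ι) 2 (volume.restrict Ω)) (i : ι) {ψ : Plane → ℝ}
    (hψ : Continuous ψ) (hc : HasCompactSupport ψ) :
    Integrable (fun x => f x i * ψ x) (volume.restrict Ω) := by
  have h1 : MemLp (fun x => f x i) 2 (volume.restrict Ω) :=
    (EuclideanSpace.proj i : EuclideanSpace ℝ ι →L[ℝ] ℝ).comp_memLp' (Lp.memLp f)
  have h2 : MemLp ψ 2 (volume.restrict Ω) := hψ.memLp_of_hasCompactSupport hc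
  exact h1.integrable_mul h2

theorem IsTestFunction.continuous_partialDeriv {Ω : Set Plane} {φ : Plane → ℝ}
    (hφ : IsTestFunction Ω φ) (j : Fin 2) : Continuous (partialDeriv j φ) :=
  (hφ.smooth.continuous_fderiv (by simp)).clm_apply continuous_const

theorem IsTestFunction.hasCompactSupport_partialDeriv {Ω : Set Plane} {φ : Plane → ℝ}
    (hφ : IsTestFunction Ω φ) (j : Fin 2) : HasCompactSupport (partialDeriv j φ) :=
  hφ.hasCompactSupport.fderiv_apply (𝕜 := ℝ) (EuclideanSpace.single j 1)

theorem integral_add_coord_mul {ι : Type} [Fintype ι] {Ω : Set Plane}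
    (f g : Lp (EuclideanSpace ℝ ι) 2 (volume.restrict Ω)) (i : ι) {ψ : Plane → ℝ}
    (hψ : Continuous ψ) (hc : HasCompactSupport ψ) :
    ∫ x in Ω, (f + g : Lp (EuclideanSpace ℝ ι) 2 (volume.restrict Ω)) x i * ψ x
      = (∫ x in Ω, f x i * ψ x) + ∫ x in Ω, g x i * ψ x := by
  rw [← integral_add (integrable_coord_mul f i hψ hc) (integrable_coord_mul g i hψ hc)]
  refine integral_congr_ae ?_
  filter_upwards [Lp.coeFn_add f g] with x hx
  rw [hx, Pi.add_apply, PiLp.add_apply, add_mul]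

theorem integral_smul_coord_mul {ι : Type} [Fintype ι] {Ω : Set Plane} (c : ℝ)
    (f : Lp (EuclideanSpace ℝ ι) 2 (volume.restrict Ω)) (i : ι) (ψ : Plane → ℝ) :
    ∫ x in Ω, (c • f : Lp (EuclideanSpace ℝ ι) 2 (volume.restrict Ω)) x i * ψ x
      = c * ∫ x in Ω, f x i * ψ x := by
  rw [← integral_const_mul]
  refine integral_congr_ae ?_
  filter_upwards [Lp.coeFn_smul c f] with x hx
  rw [hx, Pi.smul_apply, PiLp.smul_apply, smul_eq_mul, mul_assoc]

/-- The pairs `(u, Ju)` of a function in `X₀` and its square integrable weak Jacobian. -/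
def sobolevGraph (Ω : Set Plane) : Submodule ℝ (WithLp 2 (X0 Ω × L2Jac Ω)) where
  carrier := {p | IsWeakJacobian Ω p.fst p.snd}
  zero_mem' := by
    intro φ hφ i j
    have h1 := integral_smul_coord_mul (Ω := Ω) 0 0 i (partialDeriv j φ)
    have h2 := integral_smul_coord_mul (Ω := Ω) 0 0 (i, j) φ
    rw [zero_smul, zero_mul] at h1 h2
    simp only [WithLp.zero_fst, WithLp.zero_snd]
    rw [h1, h2, neg_zero]
  add_mem' := by
    intro p q hp hq φ hφ i j
    simp only [WithLp.add_fst, WithLp.add_snd]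
    rw [integral_add_coord_mul _ _ _ (hφ.continuous_partialDeriv j)
      (hφ.hasCompactSupport_partialDeriv j),
      integral_add_coord_mul _ _ _ hφ.smooth.continuous hφ.hasCompactSupport,
      hp φ hφ i j, hq φ hφ i j]
    ring
  smul_mem' := by
    intro c p hp φ hφ i j
    simp only [WithLp.smul_fst, WithLp.smul_snd]
    rw [integral_smul_coord_mul, integral_smul_coord_mul, hp φ hφ i j]
    ring

/-- The Sobolev space `X₁ = H¹(Ω) × H¹(Ω)`: all pairs `(u, Ju)` of a function in `X₀` and its
square integrable weak Jacobian, with the norm `(‖u‖² + ‖Ju‖²)^{1/2}`. -/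
def X1 (Ω : Set Plane) : Type := ↥(sobolevGraph Ω)

instance (Ω : Set Plane) : NormedAddCommGroup (X1 Ω) :=
  Submodule.normedAddCommGroup (sobolevGraph Ω)

instance (Ω : Set Plane) : NormedSpace ℝ (X1 Ω) :=
  Submodule.normedSpace (sobolevGraph Ω)

/-- The underlying element of `X₀` of an element of `X₁`. -/
def toX0 {Ω : Set Plane} (w : X1 Ω) : X0 Ω := w.1.fst

/-- The Jacobian matrix `Jw` of `w ∈ X₁` (defined almost everywhere on `Ω`). -/
def jacobian {Ω : Set Plane} (w : X1 Ω) (x : Plane) : Matrix (Fin 2) (Fin 2) ℝ :=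
  Jac.toMatrix (w.1.snd x)

/-- A cross-diffusion operator `u ↦ D(u)` on the time interval `[0, T]`: it sends a function
`u = u(t, x)` with values in `ℝ²` to a field `D(u)(t, x)` of `2 × 2` matrices. -/
abbrev DiffusionOperator (T : ℝ) : Type :=
  (Icc (0 : ℝ) T → Plane → Plane) → Icc (0 : ℝ) T → Plane → Matrix (Fin 2) (Fin 2) ℝ

/-- The structural hypotheses on the cross-diffusion operator on `closure Ω × [0, T]`. -/
structure DiffusionOperator.Admissible {T : ℝ} (D : DiffusionOperator T) (Ω : Set Plane) :
    Prop where
  /-- uniform positive definiteness -/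
  posDef : ∃ α : ℝ, 0 < α ∧ ∀ (u : Icc (0 : ℝ) T → Plane → Plane) (t : Icc (0 : ℝ) T),
    ∀ x ∈ closure Ω, ∀ ξ : Plane, α * ‖ξ‖ ^ 2 ≤ ∑ i, ∑ j, ξ i * D u t x i j * ξ j
  /-- Lipschitz continuity in the values of `u` -/
  lipschitz : ∃ L : ℝ, 0 < L ∧ ∀ (u v : Icc (0 : ℝ) T → Plane → Plane) (t : Icc (0 : ℝ) T),
    ∀ x ∈ closure Ω, ∀ i j, |D v t x i j - D u t x i j| ≤ L * ‖v t x - u t x‖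
  /-- boundedness -/
  bounded : ∃ M : ℝ, 0 < M ∧ ∀ (u : Icc (0 : ℝ) T → Plane → Plane) (t : Icc (0 : ℝ) T),
    ∀ x ∈ closure Ω, ∀ i j, |D u t x i j| ≤ M

/-- Lebesgue measure on `[0, T]`. -/
def timeMeasure (T : ℝ) : Measure (Icc (0 : ℝ) T) := Measure.comap Subtype.val volume

/-- `ζ`, a function with values in the dual of `X₁`, is the distributional derivative on `(0, T)`
of the curve `u` in `X₀`, where `X₀` is embedded in the dual of `X₁` by the `L²` pairing. -/
def IsTimeDerivative {Ω : Set Plane} {T : ℝ} (u : Icc (0 : ℝ) T → X0 Ω)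
    (ζ : Icc (0 : ℝ) T → (X1 Ω →L[ℝ] ℝ)) : Prop :=
  ∀ (w : X1 Ω) (φ : ℝ → ℝ), ContDiff ℝ ∞ φ → tsupport φ ⊆ Ioo 0 T →
    ∫ t : Icc (0 : ℝ) T, deriv φ t * inner ℝ (u t) (toX0 w) ∂timeMeasure T
      = - ∫ t : Icc (0 : ℝ) T, φ t * ζ t w ∂timeMeasure T

/-- `u ∈ C([0, T]; X₀)` is a weak solution on `Ω × (0, T]`, with initial value `u₀`, of
`∂ₜ uᵢ = div (∑ⱼ Dᵢⱼ(u) ∇uⱼ)` with the Neumann condition `∑ⱼ Dᵢⱼ(u) ∂uⱼ/∂n = 0`: it lies in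
`L²(0, T; X₁)`, it has a time derivative `ζ` in `L²(0, T; X₁')`, and
`⟨ζ(t), w⟩ + ∫_Ω tr ((Jw)ᵀ D(u) Ju) = 0` for almost all `t` and all `w ∈ X₁`. -/
def IsWeakSolution {T : ℝ} (Ω : Set Plane) (D : DiffusionOperator T) (u₀ : X0 Ω)
    (u : C(Icc (0 : ℝ) T, X0 Ω)) : Prop :=
  (∀ t : Icc (0 : ℝ) T, (t : ℝ) = 0 → u t = u₀) ∧
  ∃ (U : Icc (0 : ℝ) T → X1 Ω) (ζ : Icc (0 : ℝ) T → (X1 Ω →L[ℝ] ℝ)),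
    MemLp U 2 (timeMeasure T) ∧ (∀ᵐ t ∂timeMeasure T, toX0 (U t) = u t) ∧
    MemLp ζ 2 (timeMeasure T) ∧ IsTimeDerivative u ζ ∧
    ∀ᵐ t ∂timeMeasure T, ∀ w : X1 Ω,
      Integrable (fun x => Matrix.trace
        ((jacobian w x).transpose * D (fun s y => u s y) t x * jacobian (U t) x))
        (volume.restrict Ω) ∧
      ζ t w + ∫ x in Ω, Matrix.trace
        ((jacobian w x).transpose * D (fun s y => u s y) t x * jacobian (U t) x) = 0

/-- The scale-space operator `T_t` on `Ω`: `T_t(u₀) = u(t)`, where `u` is the unique weak solution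
with initial value `u₀`. It is a partial map, defined at the `u₀` that have a unique weak
solution. -/
def scaleSpace {T : ℝ} (Ω : Set Plane) (D : DiffusionOperator T)
    (t : Icc (0 : ℝ) T) (u₀ : X0 Ω) : Part (X0 Ω) where
  Dom := ∃! u : C(Icc (0 : ℝ) T, X0 Ω), IsWeakSolution Ω D u₀ u
  get := fun hu => hu.exists.choose t

/-- The translated domain `Ω - h = {x | x + h ∈ Ω}`. -/
def shiftDomain (h : Plane) (Ω : Set Plane) : Set Plane := (fun x => x + h) ⁻¹' Ω

theorem measurePreserving_shift (h : Plane) (Ω : Set Plane) :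
    MeasurePreserving (fun x : Plane => x + h) (volume.restrict (shiftDomain h Ω))
      (volume.restrict Ω) :=
  (measurePreserving_add_right volume h).restrict_preimage_emb
    (MeasurableEquiv.addRight h).measurableEmbedding Ω

/-- The translation `(τ_h u)(x) = u(x + h)`, which maps `X₀` on `Ω` to `X₀` on `Ω - h`. -/
def translate (h : Plane) (Ω : Set Plane) : X0 Ω →ₗᵢ[ℝ] X0 (shiftDomain h Ω) :=
  Lp.compMeasurePreservingₗᵢ ℝ (fun x : Plane => x + h) (measurePreserving_shift h Ω)

/-- The translation, applied at each time to a continuous curve in `X₀`. -/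
def translateCurve (h : Plane) (Ω : Set Plane) {T : ℝ} (u : C(Icc (0 : ℝ) T, X0 Ω)) :
    C(Icc (0 : ℝ) T, X0 (shiftDomain h Ω)) where
  toFun t := translate h Ω (u t)
  continuous_toFun := (translate h Ω).continuous.comp u.continuous

/-- `D` is invariant under the translation by `h` on `Ω`: `D(τ_h u)(t, x) = D(u)(t, x + h)`
whenever `x + h ∈ Ω`. -/
def DiffusionOperator.TranslationInvariant {T : ℝ} (D : DiffusionOperator T) (h : Plane)
    (Ω : Set Plane) : Prop :=
  ∀ (u : Icc (0 : ℝ) T → Plane → Plane) (t : Icc (0 : ℝ) T), ∀ x ∈ shiftDomain h Ω,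
    D (fun s y => u s (y + h)) t x = D u t (x + h)

end CrossDiffusion

end

namespace CrossDiffusion

/-! The shift `x ↦ x + h` carries Lebesgue measure on `Ω - h` to that on `Ω`, commutes with partial
derivatives and matches the test functions of the two domains. It therefore induces isometric
isomorphisms of `X0`, of `X1` and, by duality, of the functionals on `X1`, and each clause in the
definition of a weak solution is equivalent to its translate (`isWeakSolution_translate_iff`). The
delicate point is the coefficient: `D` acts on genuine functions, while elements of `X0` are classes
whose chosen representatives commute with the shift only almost everywhere. The Lipschitz bound
forces `D u t x` to depend on `u` only through `u t x`, so this ambiguity is harmless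
(`DiffusionOperator.apply_translate_ae`). Translation of curves is a bijection, so unique
solvability transfers too, and with it the scale-space operator. -/

theorem measurableEmbedding_shift (h : Plane) : MeasurableEmbedding (fun x : Plane => x + h) :=
  (MeasurableEquiv.addRight h).measurableEmbedding

theorem measurePreserving_shift_symm (h : Plane) (Ω : Set Plane) :
    MeasurePreserving (fun x : Plane => x + -h) (volume.restrict Ω)
      (volume.restrict (shiftDomain h Ω)) := by
  have := measurePreserving_shift (-h) (shiftDomain h Ω)
  rwa [show shiftDomain (-h) (shiftDomain h Ω) = Ω by ext x; simp [shiftDomain]] at this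

/-- Translation by `h` as a linear isometric equivalence of `L²` spaces. -/
noncomputable def translateLp (E : Type) [NormedAddCommGroup E] [NormedSpace ℝ E] (h : Plane) (Ω : Set Plane) :
    Lp E 2 (volume.restrict Ω) ≃ₗᵢ[ℝ] Lp E 2 (volume.restrict (shiftDomain h Ω)) :=
  LinearIsometryEquiv.ofSurjective
    (Lp.compMeasurePreservingₗᵢ ℝ (fun x : Plane => x + h) (measurePreserving_shift h Ω)) <| by
    -- The preimage of `g` is its shift by `-h`.
    intro g
    refine ⟨Lp.compMeasurePreserving (fun x : Plane => x + -h)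
      (measurePreserving_shift_symm h Ω) g, ?_⟩
    refine Lp.ext ?_
    refine (Lp.coeFn_compMeasurePreserving _ (measurePreserving_shift h Ω)).trans ?_
    filter_upwards [(measurePreserving_shift h Ω).quasiMeasurePreserving.ae
      (Lp.coeFn_compMeasurePreserving g (measurePreserving_shift_symm h Ω))] with x hx
    simpa using hx

theorem coeFn_translateLp {E : Type} [NormedAddCommGroup E] [NormedSpace ℝ E] (h : Plane)
    (Ω : Set Plane) (f : Lp E 2 (volume.restrict Ω)) :
    translateLp E h Ω f =ᵐ[volume.restrict (shiftDomain h Ω)] fun x => f (x + h) :=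
  Lp.coeFn_compMeasurePreserving f (measurePreserving_shift h Ω)

theorem translateLp_apply (h : Plane) (Ω : Set Plane) (f : X0 Ω) :
    translateLp Plane h Ω f = translate h Ω f :=
  rfl

theorem setIntegral_shift (h : Plane) (Ω : Set Plane) (f : Plane → ℝ) :
    ∫ x in shiftDomain h Ω, f (x + h) = ∫ x in Ω, f x :=
  (measurePreserving_shift h Ω).integral_comp (measurableEmbedding_shift h) f

theorem integrable_shift_iff (h : Plane) (Ω : Set Plane) (f : Plane → ℝ) :
    Integrable (fun x => f (x + h)) (volume.restrict (shiftDomain h Ω)) ↔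
      Integrable f (volume.restrict Ω) :=
  (measurePreserving_shift h Ω).integrable_comp_emb (measurableEmbedding_shift h)

theorem setIntegral_translateLp_coord_mul {ι : Type} [Fintype ι] (h : Plane) (Ω : Set Plane)
    (f : Lp (EuclideanSpace ℝ ι) 2 (volume.restrict Ω)) (i : ι) (ψ : Plane → ℝ) :
    ∫ x in shiftDomain h Ω, translateLp (EuclideanSpace ℝ ι) h Ω f x i * ψ (x + h)
      = ∫ x in Ω, f x i * ψ x := by
  refine Eq.trans (integral_congr_ae ?_) (setIntegral_shift h Ω fun x => f x i * ψ x)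
  filter_upwards [coeFn_translateLp h Ω f] with x hx
  rw [hx]

/-! ### Test functions and weak Jacobians under translation -/

theorem tsupport_comp_add (h : Plane) (φ : Plane → ℝ) :
    tsupport (fun x => φ (x + h)) = (fun x => x + h) ⁻¹' tsupport φ :=
  ((Homeomorph.addRight h).preimage_closure (Function.support φ)).symm

theorem isTestFunction_shift_iff (h : Plane) (Ω : Set Plane) (φ : Plane → ℝ) :
    IsTestFunction (shiftDomain h Ω) (fun x => φ (x + h)) ↔ IsTestFunction Ω φ := by
  constructor
  · intro H
    refine ⟨?_, ?_, ?_⟩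
    · have := ContDiff.comp (g := fun x => φ (x + h)) (f := fun x : Plane => x + -h)
        H.smooth (by fun_prop)
      simpa [Function.comp_def] using this
    · simpa [Function.comp_def] using
        H.hasCompactSupport.comp_homeomorph (Homeomorph.addRight (-h))
    · have := H.tsupport_subset
      rw [tsupport_comp_add] at this
      exact (add_right_surjective h).preimage_subset_preimage_iff.1 this
  · intro H
    refine ⟨H.smooth.comp (f := fun x : Plane => x + h) (by fun_prop),
      H.hasCompactSupport.comp_homeomorph (Homeomorph.addRight h), ?_⟩
    rw [tsupport_comp_add]
    exact preimage_mono H.tsupport_subset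

theorem partialDeriv_shift (h : Plane) (j : Fin 2) (φ : Plane → ℝ) (x : Plane) :
    partialDeriv j (fun y => φ (y + h)) x = partialDeriv j φ (x + h) := by
  rw [partialDeriv, partialDeriv, fderiv_comp_add_right]

/-- Every function on the plane is `φ (· + h)` for exactly one `φ`, so the quantifier over test
functions can be reindexed; a change of variables then identifies the integrals. -/
theorem isWeakJacobian_translateLp_iff (h : Plane) (Ω : Set Plane) (u : X0 Ω) (G : L2Jac Ω) :
    IsWeakJacobian (shiftDomain h Ω) (translateLp Plane h Ω u) (translateLp Jac h Ω G) ↔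
      IsWeakJacobian Ω u G := by
  refine (((Equiv.addRight h).symm.arrowCongr (Equiv.refl ℝ)).forall_congr fun φ => ?_).symm
  refine imp_congr (isTestFunction_shift_iff h Ω φ).symm (forall₂_congr fun i j => ?_)
  have h1 := setIntegral_translateLp_coord_mul h Ω u i (partialDeriv j φ)
  have h2 := setIntegral_translateLp_coord_mul h Ω G (i, j) φ
  simp only [← partialDeriv_shift] at h1
  rw [← h1, ← h2]
  rfl

/-- Translation by `h` as a linear isometric equivalence of Sobolev spaces. -/
noncomputable def translateX1 (h : Plane) (Ω : Set Plane) : X1 Ω ≃ₗᵢ[ℝ] X1 (shiftDomain h Ω) where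
  toFun w := ⟨WithLp.toLp 2 (translateLp Plane h Ω w.1.fst, translateLp Jac h Ω w.1.snd),
    (isWeakJacobian_translateLp_iff h Ω w.1.fst w.1.snd).2 w.2⟩
  invFun w := ⟨WithLp.toLp 2
      ((translateLp Plane h Ω).symm w.1.fst, (translateLp Jac h Ω).symm w.1.snd),
    (isWeakJacobian_translateLp_iff h Ω ((translateLp Plane h Ω).symm w.1.fst)
      ((translateLp Jac h Ω).symm w.1.snd)).1 <| by
        rw [LinearIsometryEquiv.apply_symm_apply, LinearIsometryEquiv.apply_symm_apply]
        exact w.2⟩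
  left_inv w := Subtype.ext <| (WithLp.ofLp_injective 2) <| Prod.ext
    ((translateLp Plane h Ω).symm_apply_apply _) ((translateLp Jac h Ω).symm_apply_apply _)
  right_inv w := Subtype.ext <| (WithLp.ofLp_injective 2) <| Prod.ext
    ((translateLp Plane h Ω).apply_symm_apply _) ((translateLp Jac h Ω).apply_symm_apply _)
  map_add' v w := Subtype.ext <| (WithLp.ofLp_injective 2) <| Prod.ext
    (map_add (translateLp Plane h Ω) _ _) (map_add (translateLp Jac h Ω) _ _)
  map_smul' c w := Subtype.ext <| (WithLp.ofLp_injective 2) <| Prod.ext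
    (map_smul (translateLp Plane h Ω) c _) (map_smul (translateLp Jac h Ω) c _)
  norm_map' w := by
    refine (WithLp.prod_norm_eq_of_L2 _).trans
      (Eq.trans ?_ (WithLp.prod_norm_eq_of_L2 w.1).symm)
    exact congrArg₂ (fun a b : ℝ => √(a ^ 2 + b ^ 2))
      ((translateLp Plane h Ω).norm_map w.1.fst) ((translateLp Jac h Ω).norm_map w.1.snd)

/-! ### The weak equation under translation -/

theorem toX0_translateX1 (h : Plane) (Ω : Set Plane) (w : X1 Ω) :
    toX0 (translateX1 h Ω w) = translate h Ω (toX0 w) :=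
  rfl

theorem jacobian_translateX1 (h : Plane) (Ω : Set Plane) (w : X1 Ω) :
    jacobian (translateX1 h Ω w) =ᵐ[volume.restrict (shiftDomain h Ω)]
      fun x => jacobian w (x + h) := by
  filter_upwards [coeFn_translateLp h Ω w.1.snd] with x hx
  exact congrArg Jac.toMatrix hx

theorem DiffusionOperator.apply_translate_ae {T : ℝ} {D : DiffusionOperator T} {h : Plane}
    {Ω : Set Plane} (hΩ : MeasurableSet Ω) (hD : D.Admissible Ω)
    (hinv : D.TranslationInvariant h Ω) (u : Icc (0 : ℝ) T → X0 Ω) (t : Icc (0 : ℝ) T) :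
    D (fun s y => translate h Ω (u s) y) t =ᵐ[volume.restrict (shiftDomain h Ω)]
      fun x => D (fun s y => u s y) t (x + h) := by
  obtain ⟨L, -, hL⟩ := hD.lipschitz
  have hm : MeasurableSet (shiftDomain h Ω) := (measurableEmbedding_shift h).measurable hΩ
  filter_upwards [coeFn_translateLp h Ω (u t), ae_restrict_mem hm] with x hx hxΩ
  -- Shifting the representative of the translated class back by `-h` gives a function on which
  -- invariance applies exactly, not just almost everywhere.
  have key := hinv (fun s y => translate h Ω (u s) (y + -h)) t x hxΩ
  simp only [add_neg_cancel_right] at key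
  rw [key]
  ext i j
  -- The two arguments agree at the point `x + h` and time `t`, so the Lipschitz bound is zero;
  -- their values at other points and times play no role.
  have := hL (fun s y => u s y) (fun s y => translate h Ω (u s) (y + -h)) t (x + h)
    (subset_closure hxΩ) i j
  rw [translateLp_apply] at hx
  simp only [add_neg_cancel_right, hx, sub_self, norm_zero, mul_zero] at this
  exact sub_eq_zero.1 (abs_nonpos_iff.1 this)

/-- Only the spatial test element `w` is reindexed: `translate` preserves inner products, and `(ζ t)
∘ e⁻¹` at `e w` is `ζ t w`, where `e` is `translateX1`. -/
theorem isTimeDerivative_translate_iff {T : ℝ} (h : Plane) (Ω : Set Plane)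
    (u : Icc (0 : ℝ) T → X0 Ω) (ζ : Icc (0 : ℝ) T → (X1 Ω →L[ℝ] ℝ)) :
    IsTimeDerivative (fun t => translate h Ω (u t))
      (fun t => (ζ t).comp ((translateX1 h Ω).symm : X1 (shiftDomain h Ω) →L[ℝ] X1 Ω)) ↔
      IsTimeDerivative u ζ := by
  refine ((translateX1 h Ω).toEquiv.forall_congr fun w => ?_).symm
  simp [toX0_translateX1]

theorem isWeakSolution_translate_iff {T : ℝ} {Ω : Set Plane} (hΩ : MeasurableSet Ω)
    {D : DiffusionOperator T} (hD : D.Admissible Ω) {h : Plane}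
    (hinv : D.TranslationInvariant h Ω) (u₀ : X0 Ω) (u : C(Icc (0 : ℝ) T, X0 Ω)) :
    IsWeakSolution (shiftDomain h Ω) D (translate h Ω u₀) (translateCurve h Ω u) ↔
      IsWeakSolution Ω D u₀ u := by
  set e := (translateX1 h Ω).toContinuousLinearEquiv with he
  set d : (X1 Ω →L[ℝ] ℝ) ≃L[ℝ] (X1 (shiftDomain h Ω) →L[ℝ] ℝ) :=
    e.arrowCongr (ContinuousLinearEquiv.refl ℝ ℝ) with hd
  have memLp_comp {E F : Type} [NormedAddCommGroup E] [NormedSpace ℝ E] [NormedAddCommGroup F]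
      [NormedSpace ℝ F] (L : E ≃L[ℝ] F) (f : Icc (0 : ℝ) T → E) :
      MemLp (fun t => L (f t)) 2 (timeMeasure T) ↔ MemLp f 2 (timeMeasure T) := by
    refine ⟨fun H => ?_, fun H => (L : E →L[ℝ] F).comp_memLp' H⟩
    simpa [Function.comp_def] using (L.symm : F →L[ℝ] E).comp_memLp' H
  refine and_congr (forall₂_congr fun t _ => (translate h Ω).injective.eq_iff) ?_
  -- The witnesses correspond bijectively, `U` to `e ∘ U` and `ζ` to `d ∘ ζ`, so the clauses can be
  -- compared one by one.
  refine (((Equiv.refl _).arrowCongr e.toEquiv).exists_congr fun U =>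
    ((Equiv.refl _).arrowCongr d.toEquiv).exists_congr fun ζ => ?_).symm
  refine and_congr (memLp_comp e U).symm <| and_congr ?_ <|
    and_congr (memLp_comp d ζ).symm <| and_congr
      (isTimeDerivative_translate_iff h Ω u ζ).symm ?_
  · refine Filter.eventually_congr (.of_forall fun t => ?_)
    exact ((congrArg (· = _) (toX0_translateX1 h Ω (U t))).to_iff.trans
      (translate h Ω).injective.eq_iff).symm
  · refine Filter.eventually_congr (.of_forall fun t => e.toEquiv.forall_congr fun w => ?_)
    have hae : (fun x => Matrix.trace ((jacobian (e w) x).transpose *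
        D (fun s y => translateCurve h Ω u s y) t x * jacobian (e (U t)) x))
        =ᵐ[volume.restrict (shiftDomain h Ω)] fun x => Matrix.trace
          ((jacobian w (x + h)).transpose * D (fun s y => u s y) t (x + h) *
            jacobian (U t) (x + h)) := by
      filter_upwards [jacobian_translateX1 h Ω w, jacobian_translateX1 h Ω (U t),
        DiffusionOperator.apply_translate_ae hΩ hD hinv u t] with x h1 h2 h3
      exact congrArg Matrix.trace (congrArg₂ _ (congrArg₂ _ (congrArg _ h1) h3) h2)
    have hint := (integrable_congr hae).trans (integrable_shift_iff h Ω fun x => Matrix.trace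
      ((jacobian w x).transpose * D (fun s y => u s y) t x * jacobian (U t) x))
    have hval := (integral_congr_ae hae).trans (setIntegral_shift h Ω fun x => Matrix.trace
      ((jacobian w x).transpose * D (fun s y => u s y) t x * jacobian (U t) x))
    refine and_congr hint.symm ?_
    have hζ : d (ζ t) (e w) = ζ t w := by simp [hd]
    exact (congrArg (· = 0) (congrArg₂ (· + ·) hζ hval)).to_iff.symm

/-- Surjectivity is what transfers uniqueness: any competing solution on `Ω - h` is the translate of
a curve on `Ω`. -/
theorem translateCurve_bijective (h : Plane) (Ω : Set Plane) {T : ℝ} :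
    Function.Bijective (translateCurve h Ω (T := T)) := by
  refine ⟨fun u v huv => ContinuousMap.ext fun t =>
    (translate h Ω).injective (DFunLike.congr_fun huv t), fun v => ?_⟩
  refine ⟨⟨fun t => (translateLp Plane h Ω).symm (v t), by fun_prop⟩, ContinuousMap.ext fun t => ?_⟩
  exact (translateLp Plane h Ω).apply_symm_apply (v t)

end CrossDiffusion

open CrossDiffusion in
theorem lemma4 {T : ℝ} (hT : 0 < T) (Ω : Set CrossDiffusion.Plane) (hΩ : IsOpen Ω)
    (D : CrossDiffusion.DiffusionOperator T) (hD : D.Admissible Ω)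
    (h : CrossDiffusion.Plane) (hinv : D.TranslationInvariant h Ω)
    (u₀ : CrossDiffusion.X0 Ω) :
    (∀ u : C(Set.Icc (0 : ℝ) T, CrossDiffusion.X0 Ω),
      CrossDiffusion.IsWeakSolution (CrossDiffusion.shiftDomain h Ω) D
        (CrossDiffusion.translate h Ω u₀) (CrossDiffusion.translateCurve h Ω u) ↔
      CrossDiffusion.IsWeakSolution Ω D u₀ u) ∧
    ∀ t : Set.Icc (0 : ℝ) T,
      CrossDiffusion.scaleSpace (CrossDiffusion.shiftDomain h Ω) D t
          (CrossDiffusion.translate h Ω u₀) =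
        (CrossDiffusion.scaleSpace Ω D t u₀).map (CrossDiffusion.translate h Ω) := by
  have key := isWeakSolution_translate_iff hΩ.measurableSet hD hinv u₀
  refine ⟨key, fun t => Part.ext' ?_ fun H H' => ?_⟩
  · exact ((translateCurve_bijective h Ω).existsUnique_iff.trans (existsUnique_congr key))
  · have h1 : IsWeakSolution Ω D u₀ (Classical.choose (ExistsUnique.exists H')) :=
      Classical.choose_spec (ExistsUnique.exists H')
    have h2 := Classical.choose_spec (ExistsUnique.exists H)
    -- The chosen solution on `Ω - h` and the translate of the one chosen on `Ω` solve the same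
    -- problem, hence coincide.
    exact DFunLike.congr_fun (ExistsUnique.unique H h2 ((key _).2 h1)) t
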